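/- **Setting.** Let $C\subseteq\mathbb R^n$ be nonempty, closed and convex, and let $f_0,f_1,\dots,f_m:\mathbb R^n\to\mathbb R$ be lower semicontinuous convex functions. Consider the problem (P): minimize $f_0(x)$ over $x\in C$ subject to $f_i(x)\le 0$, $i=1,\dots,m$, and its dual (D): maximize $g_0(y)=\inf_{x\in C}\{f_0(x)+\sum_{i=1}^m y_if_i(x)\}$ over $y\in\mathbb R^m_+$. Let $\operatorname{asym\,inf}(P)$ be the smallest value of $\limsup_k f_0(u^k)$ over all sequences $\{u^k\}\subseteq C$ with $\limsup_k f_i(u^k)\le 0$ for $i=1,\dots,m$. All norms are Euclidean. With $F=(f_1,\dots,f_m)$ put, for $x\in C$, $y\in\mathbb R^m$ and $c>0$, $$Y(x,y,c)=\Pi_{\mathbb R^m_+}[y+cF(x)],\qquad L(x,y,c)=f_0(x)+\frac1{2c}\left[\|Y(x,y,c)\|^2-\|y\|^2\right].$$ **Algorithm (accelerated iALM).** Given positive parameters $c_k$ and tolerances $\varepsilon_k=\dfrac1{(k+2)^{1+\delta}}$ with $\delta>0$, choose $y^0\in\mathbb R^m_+$ and for $k=0,1,2,\dots$ let $x^{k+1}\in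 C$ satisfy $$L(x^{k+1},y^k,c_k)-\inf_{x\in C}L(x,y^k,c_k)\le\frac{\varepsilon_k^2}{2c_k},$$ and set $$\bar y^k=Y(x^{k+1},y^k,c_k),\qquad y^{k+1}=\frac1{k+2}\,y^0+\frac{k+1}{k+2}\,\bar y^k .$$ For $k\ge1$ let $\tilde x^k=\Big(\sum_{j=1}^{k}c_{j-1}\Big)^{-1}\sum_{j=1}^{k}c_{j-1}x^j$. **Theorem 4.2.** Suppose that (D) has an optimal solution (with finite optimal value), and let $\{x^k\}$, $\{y^k\}$ be generated by the algorithm. Then $\{y^k\}$ is bounded. Let $\Delta_0$ be any constant with $\|y^k\|\le\Delta_0$ for all $k\ge0$. 1. If $\{c_k\}$ is nondecreasing, then $\operatorname{asym\,inf}(P)$ is finite and for every $k\ge1$ $$f_i(\tilde x^k)\le\frac1{c_0k}\left[3\Delta_0+2\Delta_0\ln k\right],\quad i=1,\dots,m,$$ $$f_0(\tilde x^k)-\operatorname{asym\,inf}(P)\le\frac1{2c_0k}\left[\frac{2(1+\delta)}{1+2\delta}+13\Delta_0^2+12\Delta_0^2\ln k\right].$$ 2. If $c_k=c_0(k+1)$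 for all $k$, with $c_0>0$, then $\operatorname{asym\,inf}(P)$ is finite and for every $k\ge1$ $$f_i(\tilde x^k)\le\frac2{c_0k(k+1)}\left[3\Delta_0+2\Delta_0\ln k\right],\quad i=1,\dots,m,$$ $$f_0(\tilde x^k)-\operatorname{asym\,inf}(P)\le\frac1{c_0k(k+1)}\left[\frac{2(1+\delta)}{1+2\delta}+13\Delta_0^2+12\Delta_0^2\ln k\right].$$ -/

import Mathlib

open Filter Finset

namespace IALM

variable {n m : ℕ}

/-- The dual objective `g₀(y) = inf_{x ∈ C} { f₀(x) + ∑ i, yᵢ fᵢ(x) }`, with values in the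
extended reals. -/
noncomputable def dualObjective (C : Set (EuclideanSpace ℝ (Fin n)))
    (f₀ : EuclideanSpace ℝ (Fin n) → ℝ) (f : Fin m → EuclideanSpace ℝ (Fin n) → ℝ)
    (y : EuclideanSpace ℝ (Fin m)) : EReal :=
  ⨅ x ∈ C, ((f₀ x + ∑ i, y i * f i x : ℝ) : EReal)

/-- `y` is an optimal solution of the dual problem (maximize `g₀` over `y ≥ 0`): it is feasible,
lies in the effective domain of `g₀`, and maximizes `g₀` among the nonnegative vectors. -/
def IsDualSolution (C : Set (EuclideanSpace ℝ (Fin n)))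
    (f₀ : EuclideanSpace ℝ (Fin n) → ℝ) (f : Fin m → EuclideanSpace ℝ (Fin n) → ℝ)
    (y : EuclideanSpace ℝ (Fin m)) : Prop :=
  (∀ i, 0 ≤ y i) ∧ dualObjective C f₀ f y ≠ ⊥ ∧
    ∀ u : EuclideanSpace ℝ (Fin m), (∀ i, 0 ≤ u i) →
      dualObjective C f₀ f u ≤ dualObjective C f₀ f y

/-- The multiplier update `Y(x, y, c)`: the Euclidean projection of `y + c F(x)` onto the
nonnegative orthant, i.e. its componentwise positive part (`F = (f₁, …, f_m)`). -/
noncomputable def multiplierUpdate (f : Fin m → EuclideanSpace ℝ (Fin n) → ℝ)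
    (x : EuclideanSpace ℝ (Fin n)) (y : EuclideanSpace ℝ (Fin m)) (c : ℝ) :
    EuclideanSpace ℝ (Fin m) :=
  WithLp.toLp 2 (fun i => max 0 (y i + c * f i x))

/-- The augmented Lagrangian `L(x, y, c)` at points `x ∈ C`. (It is `+∞` off `C`; below it is
only evaluated and minimized on `C`.) -/
noncomputable def augLagrangian (f₀ : EuclideanSpace ℝ (Fin n) → ℝ)
    (f : Fin m → EuclideanSpace ℝ (Fin n) → ℝ)
    (x : EuclideanSpace ℝ (Fin n)) (y : EuclideanSpace ℝ (Fin m)) (c : ℝ) : ℝ :=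
  f₀ x + 1 / (2 * c) * (‖multiplierUpdate f x y c‖ ^ 2 - ‖y‖ ^ 2)

/-- The sequences `x¹, x², …` and `y⁰, y¹, …` are generated by the (Halpern) accelerated inexact
augmented Lagrangian method with parameters `c` and tolerances `ε`. The entry `x 0` is not used. -/
structure IsAcceleratedIALM (C : Set (EuclideanSpace ℝ (Fin n)))
    (f₀ : EuclideanSpace ℝ (Fin n) → ℝ) (f : Fin m → EuclideanSpace ℝ (Fin n) → ℝ)
    (c ε : ℕ → ℝ) (x : ℕ → EuclideanSpace ℝ (Fin n)) (y : ℕ → EuclideanSpace ℝ (Fin m)) :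
    Prop where
  /-- The starting multiplier is nonnegative. -/
  init_nonneg : ∀ i, 0 ≤ y 0 i
  /-- The primal iterates lie in `C`. -/
  mem : ∀ k, x (k + 1) ∈ C
  /-- The tolerances are summable. -/
  summable_tol : Summable ε
  /-- `φ_k(x^{k+1}) - inf φ_k ≤ ε_k² / (2 c_k)`, where `φ_k = L(·, y^k, c_k)` on `C`. -/
  criterion : ∀ k,
    (augLagrangian f₀ f (x (k + 1)) (y k) (c k) : EReal)
        - ⨅ z ∈ C, (augLagrangian f₀ f z (y k) (c k) : EReal)
      ≤ ((ε k ^ 2 / (2 * c k) : ℝ) : EReal)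
  /-- `y^{k+1} = y⁰ / (k+2) + (k+1)/(k+2) • ȳ^k` with `ȳ^k = Y(x^{k+1}, y^k, c_k)`. -/
  step : ∀ k, y (k + 1) = (1 / ((k : ℝ) + 2)) • y 0
    + (((k : ℝ) + 1) / ((k : ℝ) + 2)) • multiplierUpdate f (x (k + 1)) (y k) (c k)

/-- The asymptotic infimum of the primal problem: the smallest value of `limsup f₀(u^k)` over
all sequences `u` in `C` with `limsup fᵢ(u^k) ≤ 0` for every `i`. -/
noncomputable def asymInf (C : Set (EuclideanSpace ℝ (Fin n)))
    (f₀ : EuclideanSpace ℝ (Fin n) → ℝ) (f : Fin m → EuclideanSpace ℝ (Fin n) → ℝ) : EReal :=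
  sInf {v : EReal | ∃ u : ℕ → EuclideanSpace ℝ (Fin n), (∀ k, u k ∈ C) ∧
    (∀ i, limsup (fun k => (f i (u k) : EReal)) atTop ≤ 0) ∧
    v = limsup (fun k => (f₀ (u k) : EReal)) atTop}

/-- The averaged iterate `x̃^k = ∑_{j=1}^k (c_{j-1} / ∑_{l=1}^k c_{l-1}) x^j`
(summed here over `j - 1 ∈ {0, …, k-1}`). -/
noncomputable def averaged (c : ℕ → ℝ) (x : ℕ → EuclideanSpace ℝ (Fin n)) (k : ℕ) :
    EuclideanSpace ℝ (Fin n) :=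
  ∑ j ∈ range k, (c j / ∑ l ∈ range k, c l) • x (j + 1)

end IALM

/-! An augmented Lagrangian step is an inexact proximal step on the dual. Minimizing the augmented
objective over the closure of the convex `perturbationEpigraph` yields a point `b` at which the
multiplier `y + c • b.1` supports that set. This multiplier is nonnegative, has dual value at most
the optimum `d`, and is no farther than `y` from any dual solution. Strong convexity keeps the
computed multiplier within `ε` of it (`inexact_step`).

Boundedness of `y` follows because the Halpern step is a convex combination and the errors are
summable. Solving that step for the computed multiplier leaves telescoping differences plus anchor
terms of size `1 / (j + 1)`. Their harmonic sum produces the logarithm (`sum_mul_constraint_le`,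
`sum_mul_objective_sub_le`), and Jensen transfers the sums to the averages. Weak duality gives `d ≤
asymInf`; the averages, asymptotically feasible with values asymptotically at most `d`, give
equality. -/

open scoped Topology RealInnerProductSpace

namespace IALM

/-! ### Proximal minimization over the closure of a convex set. -/

section Prox

variable {V : Type*} [NormedAddCommGroup V] [InnerProductSpace ℝ V]

/-- The augmented objective `r + ⟪y, p⟫ + (c / 2) ‖p‖²` of a perturbation-value pair `(p, r)`. -/
noncomputable def augObjective (y : V) (c : ℝ) (e : V × ℝ) : ℝ :=
  e.2 + ⟪y, e.1⟫ + c / 2 * ‖e.1‖ ^ 2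

theorem continuous_augObjective (y : V) (c : ℝ) : Continuous (augObjective y c) := by
  unfold augObjective
  fun_prop

/-- Exact second-order expansion at `b`, whose linear part has slope `y + c • b.1`. It serves both
for first-order optimality and for quadratic growth. -/
theorem augObjective_eq_add (y : V) (c : ℝ) (e b : V × ℝ) :
    augObjective y c e = augObjective y c b
      + ((e.2 + ⟪y + c • b.1, e.1⟫) - (b.2 + ⟪y + c • b.1, b.1⟫))
      + c / 2 * ‖e.1 - b.1‖ ^ 2 := by
  simp only [augObjective, inner_add_left, real_inner_smul_left, norm_sub_sq_real,
    real_inner_self_eq_norm_sq, real_inner_comm b.1 e.1]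
  ring

theorem augObjective_midpoint (y : V) (c : ℝ) (a b : V × ℝ) :
    augObjective y c ((1 / 2 : ℝ) • a + (1 / 2 : ℝ) • b)
      = (augObjective y c a + augObjective y c b) / 2 - c / 8 * ‖a.1 - b.1‖ ^ 2 := by
  have h : ‖(1 / 2 : ℝ) • a.1 + (1 / 2 : ℝ) • b.1‖ ^ 2
      = (‖a.1‖ ^ 2 + 2 * ⟪a.1, b.1⟫ + ‖b.1‖ ^ 2) / 4 := by
    rw [← smul_add, norm_smul, mul_pow, norm_add_sq_real]
    norm_num
    ring
  simp only [augObjective, Prod.fst_add, Prod.snd_add, Prod.smul_fst, Prod.smul_snd, smul_eq_mul,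
    inner_add_right, real_inner_smul_right, norm_sub_sq_real, h]
  ring

/-- The augmented objective attains its infimum over the closure of a convex set, and the
minimizer satisfies the first-order optimality condition. -/
theorem exists_augObjective_minimizer [CompleteSpace V] {E : Set (V × ℝ)} (hE : Convex ℝ E)
    (hne : E.Nonempty) (y : V) {c : ℝ} (hc : 0 < c) {B : ℝ}
    (hB : ∀ e ∈ E, B ≤ augObjective y c e) :
    ∃ b ∈ closure E, ∀ e ∈ closure E,
      b.2 + ⟪y + c • b.1, b.1⟫ ≤ e.2 + ⟪y + c • b.1, e.1⟫ := by
  set Q := augObjective y c with hQ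
  set I := sInf (Q '' E) with hI
  have hbdd : BddBelow (Q '' E) := ⟨B, by rintro _ ⟨e, he, rfl⟩; exact hB e he⟩
  have hIle : ∀ e ∈ E, I ≤ Q e := fun e he => csInf_le hbdd ⟨e, he, rfl⟩
  obtain ⟨s, -, hs, hsm⟩ := exists_seq_tendsto_sInf (hne.image Q) hbdd
  choose a haE haQ using hsm
  have hlim : Tendsto (fun k => Q (a k)) atTop (𝓝 I) := by simpa only [haQ] using hs
  -- By the midpoint identity, two nearly optimal pairs have close first components.
  have hcau : CauchySeq (fun k => (a k).1) := by
    rw [Metric.cauchySeq_iff]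
    intro ε hε
    have hev : ∀ᶠ k in atTop, Q (a k) < I + c / 8 * ε ^ 2 :=
      hlim.eventually_lt_const (by have : 0 < c / 8 * ε ^ 2 := by positivity
                                   linarith)
    obtain ⟨N, hN⟩ := eventually_atTop.1 hev
    refine ⟨N, fun i hi j hj => ?_⟩
    have hmid := hIle _ (hE (haE i) (haE j) (by norm_num : (0 : ℝ) ≤ 1 / 2)
      (by norm_num : (0 : ℝ) ≤ 1 / 2) (by norm_num))
    rw [hQ, augObjective_midpoint, ← hQ] at hmid
    have h1 := hN i hi
    have h2 := hN j hj
    have h3 : c / 8 * ‖(a i).1 - (a j).1‖ ^ 2 < c / 8 * ε ^ 2 := by linarith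
    rw [dist_eq_norm]
    exact lt_of_pow_lt_pow_left₀ 2 hε.le (lt_of_mul_lt_mul_left h3 (by positivity))
  obtain ⟨p, hp⟩ := cauchySeq_tendsto_of_complete hcau
  -- No compactness is needed in the last coordinate: the limiting value `I` determines it.
  have hr : Tendsto (fun k => (a k).2) atTop (𝓝 (I - ⟪y, p⟫ - c / 2 * ‖p‖ ^ 2)) := by
    have h1 : Tendsto (fun k => Q (a k) - ⟪y, (a k).1⟫ - c / 2 * ‖(a k).1‖ ^ 2) atTop
        (𝓝 (I - ⟪y, p⟫ - c / 2 * ‖p‖ ^ 2)) :=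
      (hlim.sub (tendsto_const_nhds.inner hp)).sub ((hp.norm.pow 2).const_mul _)
    refine h1.congr fun k => ?_
    simp only [hQ, augObjective]
    ring
  set b : V × ℝ := (p, I - ⟪y, p⟫ - c / 2 * ‖p‖ ^ 2) with hb
  have hbE : b ∈ closure E :=
    mem_closure_of_tendsto (hp.prodMk_nhds hr) (Eventually.of_forall haE)
  have hQb : Q b = I := by
    simp only [hQ, augObjective, hb]
    ring
  have hmin : ∀ e ∈ closure E, I ≤ Q e := fun e he =>
    closure_minimal (t := {e | I ≤ Q e}) hIle
      (isClosed_le continuous_const (continuous_augObjective y c)) he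
  refine ⟨b, hbE, fun e he => ?_⟩
  by_contra! hlt
  set D := (b.2 + ⟪y + c • b.1, b.1⟫) - (e.2 + ⟪y + c • b.1, e.1⟫) with hD
  have hD0 : 0 < D := sub_pos.2 hlt
  set N := c / 2 * ‖e.1 - b.1‖ ^ 2 with hN
  have hN0 : 0 ≤ N := by positivity
  -- Along the segment from `b` to `e` the objective changes by `t * (t * N - D)`; this `t` makes `t
  -- * N < D`, contradicting minimality.
  set t := D / (D + N + 1) with ht
  have hden : 0 < D + N + 1 := by linarith
  have ht0 : 0 < t := div_pos hD0 hden
  have ht1 : t ≤ 1 := (div_le_one hden).2 (by linarith)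
  have key := hmin _ (hE.closure hbE he (sub_nonneg.2 ht1) ht0.le (by ring))
  rw [hQ, augObjective_eq_add y c _ b, ← hQ, hQb] at key
  have hdiff : ((1 - t) • b + t • e).1 - b.1 = t • (e.1 - b.1) := by
    simp only [Prod.fst_add, Prod.smul_fst]
    module
  rw [hdiff, norm_smul, mul_pow, Real.norm_of_nonneg ht0.le] at key
  simp only [Prod.fst_add, Prod.smul_fst, Prod.snd_add, Prod.smul_snd, smul_eq_mul,
    inner_add_right, real_inner_smul_right] at key hD
  have h1 : 0 ≤ t * (t * N - D) := by
    rw [hN, hD]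
    linarith
  have h2 : t * (D + N + 1) = D := div_mul_cancel₀ _ hden.ne'
  have h3 : t * N - D < 0 := by nlinarith
  nlinarith

end Prox

/-! ### The augmented Lagrangian as a minimum over perturbations, and one inexact step. -/

variable {n m : ℕ} {C : Set (EuclideanSpace ℝ (Fin n))} {f₀ : EuclideanSpace ℝ (Fin n) → ℝ}
  {f : Fin m → EuclideanSpace ℝ (Fin n) → ℝ}

/-- The pairs `(p, r)` such that some `z ∈ C` has `fᵢ(z) ≤ pᵢ` for all `i` and `f₀(z) ≤ r`. -/
def perturbationEpigraph (C : Set (EuclideanSpace ℝ (Fin n)))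
    (f₀ : EuclideanSpace ℝ (Fin n) → ℝ) (f : Fin m → EuclideanSpace ℝ (Fin n) → ℝ) :
    Set (EuclideanSpace ℝ (Fin m) × ℝ) :=
  {e | ∃ z ∈ C, (∀ i, f i z ≤ e.1 i) ∧ f₀ z ≤ e.2}

theorem convex_perturbationEpigraph (hC : Convex ℝ C) (hf₀ : ConvexOn ℝ Set.univ f₀)
    (hf : ∀ i, ConvexOn ℝ Set.univ (f i)) : Convex ℝ (perturbationEpigraph C f₀ f) := by
  rintro a ⟨u, huC, hu, hu0⟩ b ⟨v, hvC, hv, hv0⟩ s t hs ht hst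
  refine ⟨s • u + t • v, hC huC hvC hs ht hst, fun i => ?_, ?_⟩
  · refine ((hf i).2 trivial trivial hs ht hst).trans ?_
    simp only [smul_eq_mul, Prod.fst_add, Prod.smul_fst, PiLp.add_apply, PiLp.smul_apply]
    exact add_le_add (mul_le_mul_of_nonneg_left (hu i) hs) (mul_le_mul_of_nonneg_left (hv i) ht)
  · refine (hf₀.2 trivial trivial hs ht hst).trans ?_
    simp only [smul_eq_mul, Prod.snd_add, Prod.smul_snd]
    exact add_le_add (mul_le_mul_of_nonneg_left hu0 hs) (mul_le_mul_of_nonneg_left hv0 ht)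

theorem inner_eq_sum_mul (u v : EuclideanSpace ℝ (Fin m)) : ⟪u, v⟫ = ∑ i, u i * v i := by
  simp [PiLp.inner_apply, mul_comm]

theorem norm_sq_eq_sum_sq (u : EuclideanSpace ℝ (Fin m)) : ‖u‖ ^ 2 = ∑ i, u i ^ 2 := by
  simp [EuclideanSpace.norm_sq_eq]

theorem augObjective_eq_norm_sq (y : EuclideanSpace ℝ (Fin m)) {c : ℝ} (hc : 0 < c)
    (e : EuclideanSpace ℝ (Fin m) × ℝ) :
    augObjective y c e = e.2 + 1 / (2 * c) * (‖y + c • e.1‖ ^ 2 - ‖y‖ ^ 2) := by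
  rw [augObjective, norm_add_sq_real, norm_smul, real_inner_smul_right, mul_pow,
    Real.norm_of_nonneg hc.le]
  field_simp
  ring

/-- Among vectors dominating `y + c F(z)` componentwise, the positive part has least norm. The bound
is attained at `augPair`. -/
theorem augLagrangian_le_augObjective (y : EuclideanSpace ℝ (Fin m)) {c : ℝ} (hc : 0 < c)
    {z : EuclideanSpace ℝ (Fin n)} {e : EuclideanSpace ℝ (Fin m) × ℝ}
    (h : ∀ i, f i z ≤ e.1 i) (h0 : f₀ z ≤ e.2) :
    augLagrangian f₀ f z y c ≤ augObjective y c e := by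
  rw [augObjective_eq_norm_sq y hc, augLagrangian]
  have hsq : ‖multiplierUpdate f z y c‖ ^ 2 ≤ ‖y + c • e.1‖ ^ 2 := by
    rw [norm_sq_eq_sum_sq, norm_sq_eq_sum_sq]
    refine sum_le_sum fun i _ => ?_
    simp only [multiplierUpdate, PiLp.add_apply, PiLp.smul_apply, smul_eq_mul]
    have hi : c * f i z ≤ c * e.1 i := mul_le_mul_of_nonneg_left (h i) hc.le
    rcases le_total (y i + c * f i z) 0 with h1 | h1
    · rw [max_eq_left h1]
      simpa using sq_nonneg (y i + c * e.1 i)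
    · rw [max_eq_right h1]
      exact pow_le_pow_left₀ h1 (by linarith) 2
  gcongr

/-- The perturbation-value pair realizing `L(z, y, c)`. -/
noncomputable def augPair (f₀ : EuclideanSpace ℝ (Fin n) → ℝ)
    (f : Fin m → EuclideanSpace ℝ (Fin n) → ℝ) (z : EuclideanSpace ℝ (Fin n))
    (y : EuclideanSpace ℝ (Fin m)) (c : ℝ) : EuclideanSpace ℝ (Fin m) × ℝ :=
  ((1 / c) • (multiplierUpdate f z y c - y), f₀ z)

theorem add_smul_augPair_fst (z : EuclideanSpace ℝ (Fin n)) (y : EuclideanSpace ℝ (Fin m))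
    {c : ℝ} (hc : 0 < c) : y + c • (augPair f₀ f z y c).1 = multiplierUpdate f z y c := by
  rw [augPair, smul_smul, mul_one_div_cancel hc.ne', one_smul, add_sub_cancel]

theorem augObjective_augPair (z : EuclideanSpace ℝ (Fin n)) (y : EuclideanSpace ℝ (Fin m))
    {c : ℝ} (hc : 0 < c) :
    augObjective y c (augPair f₀ f z y c) = augLagrangian f₀ f z y c := by
  rw [augObjective_eq_norm_sq y hc, add_smul_augPair_fst z y hc, augLagrangian, augPair]

theorem mul_le_multiplierUpdate_sub (z : EuclideanSpace ℝ (Fin n))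
    (y : EuclideanSpace ℝ (Fin m)) (c : ℝ) (i : Fin m) :
    c * f i z ≤ multiplierUpdate f z y c i - y i := by
  have : y i + c * f i z ≤ multiplierUpdate f z y c i := le_max_right _ _
  linarith

theorem augPair_mem {z : EuclideanSpace ℝ (Fin n)} (hz : z ∈ C) (y : EuclideanSpace ℝ (Fin m))
    {c : ℝ} (hc : 0 < c) : augPair f₀ f z y c ∈ perturbationEpigraph C f₀ f := by
  refine ⟨z, hz, fun i => ?_, le_rfl⟩
  have h := mul_le_multiplierUpdate_sub (f := f) z y c i
  simp only [augPair, PiLp.smul_apply, PiLp.sub_apply, smul_eq_mul]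
  rw [one_div, inv_mul_eq_div, le_div_iff₀ hc]
  linarith

/-- A dual solution, with its value `d` as a real number. -/
theorem IsDualSolution.exists_value (hC : C.Nonempty) {ystar : EuclideanSpace ℝ (Fin m)}
    (h : IsDualSolution C f₀ f ystar) :
    ∃ d : ℝ, (∀ z ∈ C, d ≤ f₀ z + ∑ i, ystar i * f i z) ∧
      ∀ u : EuclideanSpace ℝ (Fin m), (∀ i, 0 ≤ u i) → ∀ b : ℝ,
        (∀ z ∈ C, b ≤ f₀ z + ∑ i, u i * f i z) → b ≤ d := by
  obtain ⟨z₀, hz₀⟩ := hC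
  have hle : ∀ z ∈ C, dualObjective C f₀ f ystar ≤ ((f₀ z + ∑ i, ystar i * f i z : ℝ) : EReal) :=
    fun z hz => iInf₂_le z hz
  have htop : dualObjective C f₀ f ystar ≠ ⊤ :=
    ((hle z₀ hz₀).trans_lt (EReal.coe_lt_top _)).ne
  obtain ⟨d, hd⟩ : ∃ d : ℝ, dualObjective C f₀ f ystar = d :=
    ⟨_, (EReal.coe_toReal htop h.2.1).symm⟩
  refine ⟨d, fun z hz => ?_, fun u hu b hb => ?_⟩
  · have := hle z hz
    rw [hd] at this
    exact EReal.coe_le_coe_iff.1 this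
  · have h1 := h.2.2 u hu
    rw [hd] at h1
    refine EReal.coe_le_coe_iff.1 (le_trans ?_ h1)
    exact le_iInf₂ fun z hz => EReal.coe_le_coe_iff.2 (hb z hz)

/-- One inexact augmented Lagrangian step: the value is at most the dual optimal value up to the
tolerance, and the new multiplier is within `ε` of a nonexpansive step fixing `ystar`. -/
theorem inexact_step (hCne : C.Nonempty) (hC : Convex ℝ C) (hf₀ : ConvexOn ℝ Set.univ f₀)
    (hf : ∀ i, ConvexOn ℝ Set.univ (f i)) {ystar : EuclideanSpace ℝ (Fin m)}
    (hstar : ∀ i, 0 ≤ ystar i) {d : ℝ}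
    (hd : ∀ z ∈ C, d ≤ f₀ z + ∑ i, ystar i * f i z)
    (hdmax : ∀ u : EuclideanSpace ℝ (Fin m), (∀ i, 0 ≤ u i) → ∀ b : ℝ,
      (∀ z ∈ C, b ≤ f₀ z + ∑ i, u i * f i z) → b ≤ d)
    (y : EuclideanSpace ℝ (Fin m)) {c ε : ℝ} (hc : 0 < c) (hε : 0 ≤ ε)
    {z : EuclideanSpace ℝ (Fin n)} (hz : z ∈ C)
    (hcrit : ∀ w ∈ C, augLagrangian f₀ f z y c ≤ augLagrangian f₀ f w y c + ε ^ 2 / (2 * c)) :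
    augLagrangian f₀ f z y c ≤ d + ε ^ 2 / (2 * c) ∧
      ‖multiplierUpdate f z y c - ystar‖ ≤ ‖y - ystar‖ + ε := by
  set E := perturbationEpigraph C f₀ f with hE
  have hEne : E.Nonempty := ⟨_, augPair_mem hz y hc⟩
  have hdE : ∀ e ∈ E, d ≤ e.2 + ⟪ystar, e.1⟫ := by
    rintro e ⟨w, hw, hwi, hw0⟩
    rw [inner_eq_sum_mul]
    exact (hd w hw).trans (add_le_add hw0
      (sum_le_sum fun i _ => mul_le_mul_of_nonneg_left (hwi i) (hstar i)))
  have hLE : ∀ e ∈ E, augLagrangian f₀ f z y c - ε ^ 2 / (2 * c) ≤ augObjective y c e := by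
    rintro e ⟨w, hw, hwi, hw0⟩
    have h1 := hcrit w hw
    have h2 := augLagrangian_le_augObjective (f₀ := f₀) (f := f) y hc hwi hw0
    linarith
  obtain ⟨b, hb, hopt⟩ := exists_augObjective_minimizer
    (convex_perturbationEpigraph hC hf₀ hf) hEne y hc hLE
  have hLb : augLagrangian f₀ f z y c - ε ^ 2 / (2 * c) ≤ augObjective y c b :=
    closure_minimal (t := {e | _ ≤ augObjective y c e}) hLE
      (isClosed_le continuous_const (continuous_augObjective y c)) hb
  have hdb : d ≤ b.2 + ⟪ystar, b.1⟫ :=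
    closure_minimal (t := {e : EuclideanSpace ℝ (Fin m) × ℝ | d ≤ e.2 + ⟪ystar, e.1⟫}) hdE
      (isClosed_le continuous_const (by fun_prop)) hb
  set yh := y + c • b.1 with hyh
  -- `E` is closed under increasing any `p i`, so a functional bounded below on it has nonnegative
  -- coefficients.
  have hyh0 : ∀ i, 0 ≤ yh i := by
    intro i
    by_contra! hneg
    obtain ⟨w, hw⟩ := hCne
    set A := (f₀ w + ⟪yh, WithLp.toLp 2 fun i => f i w⟫) - (b.2 + ⟪yh, b.1⟫) with hA
    have hray : ∀ t : ℝ, 0 ≤ t → 0 ≤ A + t * yh i := by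
      intro t ht
      have hmem : ((WithLp.toLp 2 fun i => f i w) + EuclideanSpace.single i t, f₀ w) ∈ E := by
        refine ⟨w, hw, fun j => ?_, le_rfl⟩
        simp only [PiLp.add_apply, PiLp.single_apply]
        split_ifs <;> linarith
      have h1 := hopt _ (subset_closure hmem)
      rw [inner_add_right, EuclideanSpace.inner_single_right] at h1
      simp only [conj_trivial] at h1
      rw [hA]
      linarith
    have hA0 : 0 ≤ A := by simpa using hray 0 le_rfl
    -- At this parameter `A + t * yh i` equals `-1`.
    have h2 := hray ((A + 1) / (-yh i)) (div_nonneg (by linarith) (by linarith))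
    have h3 : (A + 1) / (-yh i) * yh i = -(A + 1) := by
      rw [div_neg, neg_mul, div_mul_cancel₀ _ hneg.ne]
    linarith
  -- Optimality at `b` makes the left side a lower bound for the Lagrangian at the feasible
  -- multiplier `yh`.
  have hbd : b.2 + ⟪yh, b.1⟫ ≤ d := by
    refine hdmax yh hyh0 _ fun w hw => ?_
    have h1 := hopt (WithLp.toLp 2 fun i => f i w, f₀ w)
      (subset_closure ⟨w, hw, fun i => le_rfl, le_rfl⟩)
    rwa [inner_eq_sum_mul yh (WithLp.toLp 2 fun i => f i w)] at h1
  have hQb : augObjective y c b ≤ d := by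
    have h1 : augObjective y c b = b.2 + ⟪yh, b.1⟫ - c / 2 * ‖b.1‖ ^ 2 := by
      rw [augObjective, hyh, inner_add_left, real_inner_smul_left, real_inner_self_eq_norm_sq]
      ring
    have h2 : 0 ≤ c / 2 * ‖b.1‖ ^ 2 := by positivity
    linarith
  refine ⟨by linarith, ?_⟩
  -- Quadratic growth at `b`: the optimality gap controls the distance of `augPair` from `b`, and
  -- scaling by `c` turns it into `ε`.
  have hnear : ‖multiplierUpdate f z y c - yh‖ ≤ ε := by
    have h1 := augObjective_eq_add y c (augPair f₀ f z y c) b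
    have h2 := hopt _ (subset_closure (augPair_mem hz y hc))
    rw [augObjective_augPair z y hc, ← hyh] at h1
    have h3 : multiplierUpdate f z y c - yh = c • ((augPair f₀ f z y c).1 - b.1) := by
      rw [← add_smul_augPair_fst (f₀ := f₀) z y hc, hyh, smul_sub]
      abel
    have h4 : c / 2 * ‖(augPair f₀ f z y c).1 - b.1‖ ^ 2 ≤ ε ^ 2 / (2 * c) := by linarith
    rw [h3, norm_smul, Real.norm_of_nonneg hc.le]
    refine (pow_le_pow_iff_left₀ (by positivity) hε two_ne_zero).1 ?_
    rw [le_div_iff₀ (by positivity)] at h4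
    rw [mul_pow]
    linarith
  -- Comparing `hdb` with `hbd` puts `b.1` at a nonobtuse angle to `ystar - yh`.
  have hfejer : ‖yh - ystar‖ ≤ ‖y - ystar‖ := by
    have h1 : 0 ≤ ⟪ystar - yh, b.1⟫ := by
      rw [inner_sub_left]
      linarith
    have h2 : y - ystar = (yh - ystar) - c • b.1 := by
      rw [hyh]
      abel
    have h3 : ⟪yh - ystar, c • b.1⟫ ≤ 0 := by
      rw [real_inner_smul_right, ← neg_sub, inner_neg_left]
      nlinarith
    refine (pow_le_pow_iff_left₀ (norm_nonneg _) (norm_nonneg _) two_ne_zero).1 ?_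
    rw [h2, norm_sub_sq_real (yh - ystar)]
    nlinarith [sq_nonneg ‖c • b.1‖]
  calc ‖multiplierUpdate f z y c - ystar‖
      = ‖(yh - ystar) + (multiplierUpdate f z y c - yh)‖ := by congr 1; abel
    _ ≤ ‖yh - ystar‖ + ‖multiplierUpdate f z y c - yh‖ := norm_add_le _ _
    _ ≤ ‖y - ystar‖ + ε := add_le_add hfejer hnear


/-! ### The Halpern iteration: bounded multipliers and telescoped estimates. -/

variable {c ε : ℕ → ℝ}
  {x : ℕ → EuclideanSpace ℝ (Fin n)} {y : ℕ → EuclideanSpace ℝ (Fin m)}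

theorem IsAcceleratedIALM.criterion_real (h : IsAcceleratedIALM C f₀ f c ε x y) (k : ℕ)
    {w : EuclideanSpace ℝ (Fin n)} (hw : w ∈ C) :
    augLagrangian f₀ f (x (k + 1)) (y k) (c k)
      ≤ augLagrangian f₀ f w (y k) (c k) + ε k ^ 2 / (2 * c k) := by
  have h1 := (EReal.sub_le_sub (le_refl (augLagrangian f₀ f (x (k + 1)) (y k) (c k) : EReal))
    (iInf₂_le w hw)).trans (h.criterion k)
  rw [← EReal.coe_sub, EReal.coe_le_coe_iff] at h1
  linarith

theorem IsAcceleratedIALM.nonneg (h : IsAcceleratedIALM C f₀ f c ε x y) (k : ℕ) (i : Fin m) :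
    0 ≤ y k i := by
  cases k with
  | zero => exact h.init_nonneg i
  | succ k =>
    rw [h.step k]
    have h1 := h.init_nonneg i
    have h2 : 0 ≤ multiplierUpdate f (x (k + 1)) (y k) (c k) i := le_max_left _ _
    simp only [PiLp.add_apply, PiLp.smul_apply, smul_eq_mul]
    positivity

theorem IsAcceleratedIALM.multiplierUpdate_eq (h : IsAcceleratedIALM C f₀ f c ε x y) (k : ℕ) :
    multiplierUpdate f (x (k + 1)) (y k) (c k)
      = y (k + 1) + (1 / ((k : ℝ) + 1)) • (y (k + 1) - y 0) := by
  have h1 : (k : ℝ) + 1 ≠ 0 := by positivity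
  have h2 : (k : ℝ) + 2 ≠ 0 := by positivity
  ext i
  simp only [h.step k, PiLp.add_apply, PiLp.sub_apply, PiLp.smul_apply, smul_eq_mul]
  field_simp
  ring

/-- The anchor `y 0` and the update both lie in the ball about `ystar` whose radius is the initial
distance plus the accumulated errors, hence so does their convex combination. -/
theorem IsAcceleratedIALM.bounded (h : IsAcceleratedIALM C f₀ f c ε x y) (hε : ∀ k, 0 ≤ ε k)
    {ystar : EuclideanSpace ℝ (Fin m)}
    (hstep : ∀ k, ‖multiplierUpdate f (x (k + 1)) (y k) (c k) - ystar‖ ≤ ‖y k - ystar‖ + ε k) :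
    ∃ B : ℝ, ∀ k, ‖y k‖ ≤ B := by
  have hsum : ∀ k, ‖y k - ystar‖ ≤ ‖y 0 - ystar‖ + ∑ j ∈ range k, ε j := by
    intro k
    induction k with
    | zero => simp
    | succ k ih =>
      have hdec : y (k + 1) - ystar = (1 / ((k : ℝ) + 2)) • (y 0 - ystar)
          + (((k : ℝ) + 1) / ((k : ℝ) + 2)) •
            (multiplierUpdate f (x (k + 1)) (y k) (c k) - ystar) := by
        have h2 : (k : ℝ) + 2 ≠ 0 := by positivity
        rw [h.step k]
        ext i
        simp only [PiLp.add_apply, PiLp.sub_apply, PiLp.smul_apply, smul_eq_mul]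
        field_simp
        ring
      set S := ‖y 0 - ystar‖ + ∑ j ∈ range (k + 1), ε j with hS
      have h0 : ‖y 0 - ystar‖ ≤ S := le_add_of_nonneg_right (sum_nonneg fun j _ => hε j)
      have h1 : ‖multiplierUpdate f (x (k + 1)) (y k) (c k) - ystar‖ ≤ S := by
        rw [hS, sum_range_succ]
        linarith [hstep k]
      calc ‖y (k + 1) - ystar‖
          ≤ 1 / ((k : ℝ) + 2) * ‖y 0 - ystar‖ + ((k : ℝ) + 1) / ((k : ℝ) + 2) *
            ‖multiplierUpdate f (x (k + 1)) (y k) (c k) - ystar‖ := by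
            rw [hdec]
            refine (norm_add_le _ _).trans_eq ?_
            rw [norm_smul, norm_smul, Real.norm_of_nonneg (by positivity),
              Real.norm_of_nonneg (by positivity)]
        _ ≤ 1 / ((k : ℝ) + 2) * S + ((k : ℝ) + 1) / ((k : ℝ) + 2) * S := by gcongr
        _ = S := by
            field_simp
            ring
  refine ⟨‖y 0 - ystar‖ + ∑' j, ε j + ‖ystar‖, fun k => ?_⟩
  have h1 : ‖y k‖ ≤ ‖y k - ystar‖ + ‖ystar‖ := by
    simpa using norm_add_le (y k - ystar) ystar
  have h2 := h.summable_tol.sum_le_tsum (range k) fun j _ => hε j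
  linarith [hsum k]

theorem sum_one_div_le_one_add_log (k : ℕ) :
    ∑ j ∈ range k, 1 / ((j : ℝ) + 1) ≤ 1 + Real.log k := by
  have h := harmonic_le_one_add_log k
  simpa [harmonic] using h

/-- Each term is at most a multiplier increment plus an anchor term; the increments telescope and
the anchor terms sum harmonically. -/
theorem IsAcceleratedIALM.sum_mul_constraint_le (h : IsAcceleratedIALM C f₀ f c ε x y)
    {B : ℝ} (hB : ∀ k, ‖y k‖ ≤ B) (k : ℕ) (i : Fin m) :
    ∑ j ∈ range k, c j * f i (x (j + 1)) ≤ 2 * B + B * Real.log k := by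
  have hle : ∀ j, y j i - y 0 i ≤ B := fun j => by
    have h1 := (Real.le_norm_self _).trans (PiLp.norm_apply_le (y j) i)
    linarith [h.init_nonneg i, hB j]
  have hB0 : 0 ≤ B := (norm_nonneg _).trans (hB 0)
  calc ∑ j ∈ range k, c j * f i (x (j + 1))
      ≤ ∑ j ∈ range k, ((y (j + 1) i - y j i) + 1 / ((j : ℝ) + 1) * B) := by
        refine sum_le_sum fun j _ => ?_
        have h1 := mul_le_multiplierUpdate_sub (f := f) (x (j + 1)) (y j) (c j) i
        rw [h.multiplierUpdate_eq j] at h1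
        simp only [PiLp.add_apply, PiLp.sub_apply, PiLp.smul_apply, smul_eq_mul] at h1
        have h2 : 1 / ((j : ℝ) + 1) * (y (j + 1) i - y 0 i) ≤ 1 / ((j : ℝ) + 1) * B :=
          mul_le_mul_of_nonneg_left (hle _) (by positivity)
        linarith
    _ = (y k i - y 0 i) + (∑ j ∈ range k, 1 / ((j : ℝ) + 1)) * B := by
        rw [sum_add_distrib, sum_range_sub (fun j => y j i), sum_mul]
    _ ≤ B + (1 + Real.log k) * B :=
        add_le_add (hle k) (mul_le_mul_of_nonneg_right (sum_one_div_le_one_add_log k) hB0)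
    _ = 2 * B + B * Real.log k := by ring

theorem IsAcceleratedIALM.sum_mul_objective_sub_le (h : IsAcceleratedIALM C f₀ f c ε x y)
    (hc : ∀ k, 0 < c k) {d : ℝ}
    (hval : ∀ k, augLagrangian f₀ f (x (k + 1)) (y k) (c k) ≤ d + ε k ^ 2 / (2 * c k))
    {T : ℝ} (hT : ∀ k, ∑ j ∈ range k, ε j ^ 2 ≤ T) {B : ℝ} (hB : ∀ k, ‖y k‖ ≤ B) (k : ℕ) :
    ∑ j ∈ range k, c j * (f₀ (x (j + 1)) - d)
      ≤ (T + 3 * B ^ 2 + 2 * B ^ 2 * Real.log k) / 2 := by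
  have hB0 : 0 ≤ B := (norm_nonneg _).trans (hB 0)
  calc ∑ j ∈ range k, c j * (f₀ (x (j + 1)) - d)
      ≤ ∑ j ∈ range k, (ε j ^ 2 / 2 - (‖y (j + 1)‖ ^ 2 - ‖y j‖ ^ 2) / 2
          + 1 / ((j : ℝ) + 1) * B ^ 2) := by
        refine sum_le_sum fun j _ => ?_
        set r := 1 / ((j : ℝ) + 1) with hr
        have hr0 : 0 ≤ r := by positivity
        have h1 := mul_le_mul_of_nonneg_left (hval j) (hc j).le
        have hcj := (hc j).ne'
        have e1 : c j * (d + ε j ^ 2 / (2 * c j)) = c j * d + ε j ^ 2 / 2 := by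
          field_simp
        have e2 : c j * augLagrangian f₀ f (x (j + 1)) (y j) (c j) = c j * f₀ (x (j + 1))
            + (‖multiplierUpdate f (x (j + 1)) (y j) (c j)‖ ^ 2 - ‖y j‖ ^ 2) / 2 := by
          rw [augLagrangian]
          field_simp
        -- In the expanded square only the cross term `-2 * r * ⟪y (j + 1), y 0⟫` can be negative
        -- among those beyond `‖y (j + 1)‖ ^ 2`; the others are dropped.
        rw [e1, e2, h.multiplierUpdate_eq j, ← hr, norm_add_sq_real, real_inner_smul_right,
          inner_sub_right, real_inner_self_eq_norm_sq] at h1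
        have h2 : ⟪y (j + 1), y 0⟫ ≤ B ^ 2 := by
          refine (real_inner_le_norm _ _).trans ?_
          rw [sq]
          exact mul_le_mul (hB _) (hB _) (norm_nonneg _) hB0
        have h3 := mul_le_mul_of_nonneg_left h2 hr0
        have h4 : 0 ≤ r * ‖y (j + 1)‖ ^ 2 := by positivity
        have h5 : 0 ≤ ‖r • (y (j + 1) - y 0)‖ ^ 2 := by positivity
        linarith
    _ = (∑ j ∈ range k, ε j ^ 2) / 2 - (‖y k‖ ^ 2 - ‖y 0‖ ^ 2) / 2
          + (∑ j ∈ range k, 1 / ((j : ℝ) + 1)) * B ^ 2 := by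
        rw [sum_add_distrib, sum_sub_distrib, ← sum_div, ← sum_div,
          sum_range_sub (fun j => ‖y j‖ ^ 2), sum_mul]
    _ ≤ T / 2 + B ^ 2 / 2 + (1 + Real.log k) * B ^ 2 := by
        have h1 := mul_le_mul_of_nonneg_right (sum_one_div_le_one_add_log k) (sq_nonneg B)
        have h2 := hT k
        have h3 : ‖y 0‖ ^ 2 ≤ B ^ 2 := pow_le_pow_left₀ (norm_nonneg _) (hB 0) 2
        have h4 := sq_nonneg ‖y k‖
        linarith
    _ = (T + 3 * B ^ 2 + 2 * B ^ 2 * Real.log k) / 2 := by ring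

/-! ### Weighted averages, the asymptotic infimum and the tolerances. -/

theorem sum_weights_pos (hc : ∀ k, 0 < c k) {k : ℕ} (hk : 1 ≤ k) : 0 < ∑ j ∈ range k, c j :=
  sum_pos (fun j _ => hc j) ⟨0, mem_range.2 hk⟩

theorem averaged_mem (hC : Convex ℝ C) (hc : ∀ k, 0 < c k) (hx : ∀ k, x (k + 1) ∈ C) {k : ℕ}
    (hk : 1 ≤ k) : averaged c x k ∈ C := by
  have hS := sum_weights_pos hc hk
  refine hC.sum_mem (fun j _ => (div_pos (hc j) hS).le) ?_ fun j _ => hx j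
  rw [← sum_div, div_self hS.ne']

/-- Jensen's inequality; the shift `d` is the dual value for the objective and `0` for the
constraints. -/
theorem map_averaged_le {g : EuclideanSpace ℝ (Fin n) → ℝ} (hg : ConvexOn ℝ Set.univ g)
    (hc : ∀ k, 0 < c k) {k : ℕ} (hk : 1 ≤ k) {d K : ℝ}
    (h : ∑ j ∈ range k, c j * (g (x (j + 1)) - d) ≤ K) :
    g (averaged c x k) - d ≤ K / ∑ j ∈ range k, c j := by
  have hS := sum_weights_pos hc hk
  have hw : ∑ j ∈ range k, c j / ∑ l ∈ range k, c l = 1 := by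
    rw [← sum_div, div_self hS.ne']
  have h1 := hg.map_sum_le (t := range k) (p := fun j => x (j + 1))
    (fun j _ => (div_pos (hc j) hS).le) hw (fun j _ => trivial)
  rw [le_div_iff₀ hS]
  refine le_trans ?_ h
  have h2 : ∑ j ∈ range k, c j * (g (x (j + 1)) - d)
      = ((∑ j ∈ range k, (c j / ∑ l ∈ range k, c l) • g (x (j + 1))) - d)
        * ∑ j ∈ range k, c j := by
    simp only [smul_eq_mul, div_mul_eq_mul_div, ← sum_div, mul_sub, sum_sub_distrib, ← sum_mul]
    field_simp
  rw [h2]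
  exact mul_le_mul_of_nonneg_right (sub_le_sub_right h1 d) hS.le

theorem tendsto_affine_log_div_natCast (a b : ℝ) :
    Tendsto (fun k : ℕ => (a + b * Real.log k) / k) atTop (𝓝 0) := by
  have h1 : Tendsto (fun k : ℕ => Real.log k / k) atTop (𝓝 0) :=
    (Real.isLittleO_log_id_atTop.tendsto_div_nhds_zero).comp tendsto_natCast_atTop_atTop
  have h2 := (tendsto_const_div_atTop_nhds_zero_nat a).add (h1.const_mul b)
  rw [mul_zero, add_zero] at h2
  refine h2.congr fun k => ?_
  ring

/-- Weak duality with a uniform constraint slack `η`, which is then sent to zero. -/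
theorem le_asymInf {ystar : EuclideanSpace ℝ (Fin m)} (hstar : ∀ i, 0 ≤ ystar i) {d : ℝ}
    (hd : ∀ z ∈ C, d ≤ f₀ z + ∑ i, ystar i * f i z) : (d : EReal) ≤ asymInf C f₀ f := by
  refine le_sInf ?_
  rintro _ ⟨u, hu, hlim, rfl⟩
  refine EReal.le_of_forall_lt_iff_le.1 fun r hr => ?_
  have hr' : ∀ᶠ k in atTop, f₀ (u k) < r := by
    filter_upwards [eventually_lt_of_limsup_lt hr] with k hk using EReal.coe_lt_coe_iff.1 hk
  have hη : ∀ η : ℝ, 0 < η → d ≤ r + η * ∑ i, ystar i := by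
    intro η hη
    have h1 : ∀ᶠ k in atTop, ∀ i, f i (u k) < η := by
      rw [eventually_all]
      intro i
      have h2 : limsup (fun k => (f i (u k) : EReal)) atTop < (η : EReal) :=
        (hlim i).trans_lt (EReal.coe_pos.2 hη)
      filter_upwards [eventually_lt_of_limsup_lt h2] with k hk using EReal.coe_lt_coe_iff.1 hk
    obtain ⟨k, hk1, hk2⟩ := (h1.and hr').exists
    have h3 : ∑ i, ystar i * f i (u k) ≤ ∑ i, ystar i * η :=
      sum_le_sum fun i _ => mul_le_mul_of_nonneg_left (hk1 i).le (hstar i)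
    rw [← sum_mul] at h3
    linarith [hd _ (hu k)]
  have hlimη : Tendsto (fun η : ℝ => r + η * ∑ i, ystar i) (𝓝[>] 0) (𝓝 (r + 0 * ∑ i, ystar i)) :=
    ((continuous_const.add (continuous_id.mul continuous_const)).tendsto 0).mono_left
      nhdsWithin_le_nhds
  rw [zero_mul, add_zero] at hlimη
  exact EReal.coe_le_coe_iff.2 (ge_of_tendsto hlimη (eventually_mem_nhdsWithin.mono hη))

theorem asymInf_le {d : ℝ} {u : ℕ → EuclideanSpace ℝ (Fin n)} (hu : ∀ k, u k ∈ C)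
    {a b : ℕ → ℝ} (ha : Tendsto a atTop (𝓝 0)) (hb : Tendsto b atTop (𝓝 0))
    (hfa : ∀ i k, f i (u k) ≤ a k) (hfb : ∀ k, f₀ (u k) - d ≤ b k) :
    asymInf C f₀ f ≤ d := by
  have hlim : ∀ (g v : ℕ → ℝ) (l : ℝ), (∀ k, g k ≤ v k) → Tendsto v atTop (𝓝 l) →
      limsup (fun k => (g k : EReal)) atTop ≤ l := by
    intro g v l hgv hv
    have hv' : Tendsto (fun k => (v k : EReal)) atTop (𝓝 (l : EReal)) := EReal.tendsto_coe.2 hv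
    rw [← hv'.limsup_eq]
    exact limsup_le_limsup (Eventually.of_forall fun k => EReal.coe_le_coe_iff.2 (hgv k))
  unfold asymInf
  refine sInf_le_of_le (b := limsup (fun k => (f₀ (u k) : EReal)) atTop)
    ⟨u, hu, fun i => hlim _ a 0 (hfa i) ha, rfl⟩ ?_
  refine hlim _ (fun k => d + b k) d (fun k => by linarith [hfb k]) ?_
  simpa using hb.const_add d

/-- Comparison with the telescoping series of `1 / ((j + 1) * (j + 2))` already bounds the sum by
`1`, which is below the right side. -/
theorem sum_sq_tolerance_le {δ : ℝ} (hδ : 0 < δ) (k : ℕ) :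
    ∑ j ∈ range k, (1 / ((j : ℝ) + 2) ^ (1 + δ)) ^ 2 ≤ 2 * (1 + δ) / (1 + 2 * δ) := by
  have hterm : ∀ j : ℕ, (1 / ((j : ℝ) + 2) ^ (1 + δ)) ^ 2
      ≤ 1 / ((j : ℝ) + 1) - 1 / (((j + 1 : ℕ) : ℝ) + 1) := by
    intro j
    have h1 : (j : ℝ) + 2 ≤ ((j : ℝ) + 2) ^ (1 + δ) :=
      Real.self_le_rpow_of_one_le (by linarith [j.cast_nonneg (α := ℝ)]) (by linarith)
    calc (1 / ((j : ℝ) + 2) ^ (1 + δ)) ^ 2 ≤ (1 / ((j : ℝ) + 2)) ^ 2 := by gcongr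
      _ ≤ 1 / (((j : ℝ) + 1) * ((j : ℝ) + 2)) := by
          rw [one_div_pow]
          apply one_div_le_one_div_of_le (by positivity)
          nlinarith [j.cast_nonneg (α := ℝ)]
      _ = 1 / ((j : ℝ) + 1) - 1 / (((j + 1 : ℕ) : ℝ) + 1) := by
          push_cast
          field_simp
          ring
  refine (sum_le_sum fun j _ => hterm j).trans ?_
  rw [sum_range_sub' (fun j : ℕ => 1 / ((j : ℝ) + 1))]
  have h1 : 0 ≤ 1 / ((k : ℝ) + 1) := by positivity
  have h2 : 1 ≤ 2 * (1 + δ) / (1 + 2 * δ) := by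
    rw [le_div_iff₀ (by linarith)]
    linarith
  simp only [Nat.cast_zero, zero_add, div_one]
  linarith

end IALM

/-! ### Assembly of the two parameter regimes. -/

theorem theorem4p2 {n m : ℕ}
    (C : Set (EuclideanSpace ℝ (Fin n))) (hCne : C.Nonempty) (hCcl : IsClosed C)
    (hCconv : Convex ℝ C)
    (f₀ : EuclideanSpace ℝ (Fin n) → ℝ) (f : Fin m → EuclideanSpace ℝ (Fin n) → ℝ)
    (hf₀conv : ConvexOn ℝ Set.univ f₀) (hf₀lsc : LowerSemicontinuous f₀)
    (hfconv : ∀ i, ConvexOn ℝ Set.univ (f i)) (hflsc : ∀ i, LowerSemicontinuous (f i))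
    (hD : ∃ ystar, IALM.IsDualSolution C f₀ f ystar)
    (c : ℕ → ℝ) (hc : ∀ k, 0 < c k) (δ : ℝ) (hδ : 0 < δ)
    (x : ℕ → EuclideanSpace ℝ (Fin n)) (y : ℕ → EuclideanSpace ℝ (Fin m))
    (hrun : IALM.IsAcceleratedIALM C f₀ f c (fun k => 1 / ((k : ℝ) + 2) ^ (1 + δ)) x y) :
    -- a constant `Δ₀` bounding the multipliers exists
    (∃ Δ₀ : ℝ, ∀ k, ‖y k‖ ≤ Δ₀) ∧
    -- (1) nondecreasing parameters
    (Monotone c →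
      ∃ p : ℝ, IALM.asymInf C f₀ f = (p : EReal) ∧
        ∀ Δ₀ : ℝ, (∀ k, ‖y k‖ ≤ Δ₀) → ∀ k : ℕ, 1 ≤ k →
          (∀ i, f i (IALM.averaged c x k)
            ≤ 1 / (c 0 * k) * (3 * Δ₀ + 2 * Δ₀ * Real.log k)) ∧
          f₀ (IALM.averaged c x k) - p
            ≤ 1 / (2 * c 0 * k) *
              (2 * (1 + δ) / (1 + 2 * δ) + 13 * Δ₀ ^ 2 + 12 * Δ₀ ^ 2 * Real.log k)) ∧
    -- (2) linearly growing parameters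
    ((∀ k : ℕ, c k = c 0 * ((k : ℝ) + 1)) →
      ∃ p : ℝ, IALM.asymInf C f₀ f = (p : EReal) ∧
        ∀ Δ₀ : ℝ, (∀ k, ‖y k‖ ≤ Δ₀) → ∀ k : ℕ, 1 ≤ k →
          (∀ i, f i (IALM.averaged c x k)
            ≤ 2 / (c 0 * k * ((k : ℝ) + 1)) * (3 * Δ₀ + 2 * Δ₀ * Real.log k)) ∧
          f₀ (IALM.averaged c x k) - p
            ≤ 1 / (c 0 * k * ((k : ℝ) + 1)) *
              (2 * (1 + δ) / (1 + 2 * δ) + 13 * Δ₀ ^ 2 + 12 * Δ₀ ^ 2 * Real.log k)) := by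
  obtain ⟨ystar, hystar⟩ := hD
  obtain ⟨d, hd, hdmax⟩ := hystar.exists_value hCne
  have hstep := fun k => IALM.inexact_step hCne hCconv hf₀conv hfconv hystar.1 hd hdmax (y k)
    (hc k) (by positivity : (0 : ℝ) ≤ 1 / ((k : ℝ) + 2) ^ (1 + δ)) (hrun.mem k)
    (fun w hw => hrun.criterion_real k hw)
  have hbdd := hrun.bounded (fun k => by positivity) fun k => (hstep k).2
  set T := 2 * (1 + δ) / (1 + 2 * δ) with hT
  have hT0 : 0 ≤ T := by positivity
  -- Here `s` is `c 0 * k` for nondecreasing parameters and the exact weight sum for linear ones.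
  -- The summed estimates have smaller constants than `3, 2, 13, 12`, so the rest is slack.
  have hmain : ∀ (B : ℝ), (∀ k, ‖y k‖ ≤ B) → ∀ (k : ℕ), 1 ≤ k → ∀ s : ℝ, 0 < s →
      s ≤ ∑ j ∈ range k, c j →
      (∀ i, f i (IALM.averaged c x k) ≤ 1 / s * (3 * B + 2 * B * Real.log k)) ∧
        f₀ (IALM.averaged c x k) - d
          ≤ 1 / (2 * s) * (T + 13 * B ^ 2 + 12 * B ^ 2 * Real.log k) := by
    intro B hB k hk s hs hsle
    have hB0 : 0 ≤ B := (norm_nonneg _).trans (hB 0)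
    have hlog : 0 ≤ Real.log k := Real.log_natCast_nonneg k
    have hBl : 0 ≤ B * Real.log k := mul_nonneg hB0 hlog
    have hBl2 : 0 ≤ B ^ 2 * Real.log k := mul_nonneg (sq_nonneg B) hlog
    have hB2 := sq_nonneg B
    refine ⟨fun i => ?_, ?_⟩
    · have h1 := hrun.sum_mul_constraint_le hB k i
      have h2 := IALM.map_averaged_le (x := x) (d := 0) (hfconv i) hc hk
        (K := 3 * B + 2 * B * Real.log k) (by simp only [sub_zero]; linarith)
      rw [sub_zero] at h2
      rw [one_div_mul_eq_div]
      exact h2.trans (div_le_div_of_nonneg_left (by linarith) hs hsle)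
    · have h1 := hrun.sum_mul_objective_sub_le hc (fun k => (hstep k).1)
        (IALM.sum_sq_tolerance_le hδ) hB k
      rw [← hT] at h1
      have h2 := IALM.map_averaged_le (x := x) (d := d) hf₀conv hc hk
        (K := (T + 13 * B ^ 2 + 12 * B ^ 2 * Real.log k) / 2) (by linarith)
      rw [one_div_mul_eq_div, ← div_div]
      exact h2.trans (div_le_div_of_nonneg_left (by linarith) hs hsle)
  have hmono : Monotone c → ∀ k : ℕ, c 0 * k ≤ ∑ j ∈ range k, c j := by
    intro hcm k
    have h1 := card_nsmul_le_sum (range k) c (c 0) fun j _ => hcm (Nat.zero_le j)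
    rw [card_range, nsmul_eq_mul] at h1
    linarith
  have hasym : Monotone c → IALM.asymInf C f₀ f = (d : EReal) := by
    intro hcm
    obtain ⟨B, hB⟩ := hbdd
    refine le_antisymm ?_ (IALM.le_asymInf hystar.1 hd)
    -- The index is shifted because the average over the empty range is `0`, which need not lie in
    -- `C`.
    have hbound := fun k : ℕ => hmain B hB (k + 1) (Nat.le_add_left 1 k) _
      (mul_pos (hc 0) (Nat.cast_pos.2 k.succ_pos)) (hmono hcm (k + 1))
    refine IALM.asymInf_le
      (fun k => IALM.averaged_mem hCconv hc hrun.mem (Nat.le_add_left 1 k)) ?_ ?_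
      (fun i k => (hbound k).1 i) (fun k => (hbound k).2)
    · have h1 := (((IALM.tendsto_affine_log_div_natCast (3 * B) (2 * B)).comp
        (tendsto_add_atTop_nat 1)).const_mul (1 / c 0))
      rw [mul_zero] at h1
      refine h1.congr fun k => ?_
      simp only [Function.comp_apply]
      ring
    · have h1 := (((IALM.tendsto_affine_log_div_natCast (T + 13 * B ^ 2) (12 * B ^ 2)).comp
        (tendsto_add_atTop_nat 1)).const_mul (1 / (2 * c 0)))
      rw [mul_zero] at h1
      refine h1.congr fun k => ?_
      simp only [Function.comp_apply]
      ring
  refine ⟨hbdd, fun hcm => ⟨d, hasym hcm, fun B hB k hk => ?_⟩, fun hcl => ?_⟩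
  · have h1 := hmain B hB k hk _ (mul_pos (hc 0) (Nat.cast_pos.2 hk)) (hmono hcm k)
    rwa [← mul_assoc 2 (c 0)] at h1
  · have hcm : Monotone c := by
      intro i j hij
      rw [hcl i, hcl j]
      have h1 : (i : ℝ) ≤ j := Nat.cast_le.2 hij
      exact mul_le_mul_of_nonneg_left (by linarith) (hc 0).le
    have hsum : ∀ k : ℕ, ∑ j ∈ range k, c j = c 0 * k * ((k : ℝ) + 1) / 2 := by
      intro k
      induction k with
      | zero => simp
      | succ k ih =>
        rw [sum_range_succ, ih, hcl k]
        push_cast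
        ring
    refine ⟨d, hasym hcm, fun B hB k hk => ?_⟩
    have h1 := hmain B hB k hk _ (IALM.sum_weights_pos hc hk) le_rfl
    rw [hsum k, mul_div_cancel₀ _ (two_ne_zero' ℝ), one_div_div] at h1
    exact h1
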